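/- Let $H_n(x)=(-1)^n e^{x^2}\frac{d^n}{dx^n}e^{-x^2}$ denote the Hermite polynomials. Let $r_1,r_2,r_3$ be nonnegative integers, $x=(x_1,x_2,x_3)\in\mathbb R^3$, and let $u_1,u_2,u_3\in\mathbb R$ satisfy $$4(u_1^2+u_2^2+u_3^2)+16\,|u_1u_2u_3|<1 .$$ (Equivalently, the symmetric matrix $2M$, where $M$ has zero diagonal and $M_{ij}=u_k$ for $\{i,j,k\}=\{1,2,3\}$, has operator norm less than $1$.) Put $\Delta=1-4(u_1^2+u_2^2+u_3^2)+16u_1u_2u_3$ and, for $\{i,j,k\}=\{1,2,3\}$, $$X_i(x)=\frac{(1-4u_i^2)x_i-2\sum_{j\ne i}(u_k-2u_iu_j)x_j}{\sqrt{\Delta(1-4u_i^2)}} .$$ Then the following triple series converges absolutely and $$\sum_{m,n,p=0}^{\infty} H_{n+p+r_1}(x_1)\,H_{p+m+r_2}(x_2)\,H_{m+n+r_3}(x_3)\,\frac{u_1^m}{m!}\frac{u_2^n}{n!}\frac{u_3^p}{p!}$$ $$=\Delta^{-\frac{r_1+r_2+r_3+1}{2}}\prod_{i=1}^3(1-4u_i^2)^{\frac{r_i}{2}}\;\exp\Bigl(\sum_i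 x_i^2-\frac{\sum_i x_i^2-4\sum_i x_i^2u_i^2-4\sum_{\{i,j\}}x_ix_ju_k+8\sum_{\{i,j\}}u_iu_jx_ix_j}{\Delta}\Bigr)$$ $$\cdot\sum_{(k_1,k_2)\in\Lambda_3}\;\prod_{i=1}^{2}\Bigl(-\sqrt{\tfrac{\Delta}{1-4u_{i+1}^2}}\Bigr)^{k_i}\binom{r_{i+1}}{k_i}\;H_{r_3-k_2}(X_3(x))\,D_3^{k_2}\bigl[H_{r_2-k_1}(X_2(x))\,D_2^{k_1}H_{r_1}(X_1(x))\bigr],$$ where $D_i=\partial/\partial x_i$, the sums over $\{i,j\}$ run over the three unordered pairs of distinct indices in $\{1,2,3\}$, $k$ is the remaining index, and $$\Lambda_3=\{(k_1,k_2)\in\mathbb Z_{\ge0}^2:\ k_1\le\min\{r_1,r_2\},\ k_2\le\min\{r_3,\,r_1+r_2-2k_1\}\}.$$ -/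

import Mathlib

noncomputable section

namespace CarlitzMehler

/-- The physicists' Hermite polynomial function `H_n(x) = (-1)^n e^{x^2} D^n e^{-x^2}`. -/
def hermiteH (n : ℕ) (x : ℝ) : ℝ :=
  (-1) ^ n * Real.exp (x ^ 2) * iteratedDeriv n (fun y : ℝ => Real.exp (-y ^ 2)) x

/-- The partial derivative `D_i f = ∂f/∂x_i` of a function of three real variables. -/
def pderiv (i : Fin 3) (f : (Fin 3 → ℝ) → ℝ) : (Fin 3 → ℝ) → ℝ :=
  fun x => deriv (fun t : ℝ => f (Function.update x i t)) (x i)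

/-- `Δ = 1 - 4 ∑ u_i^2 + 16 u_1 u_2 u_3`. The indices `1, 2, 3` are `0, 1, 2 : Fin 3` throughout. -/
def discr (u : Fin 3 → ℝ) : ℝ :=
  1 - 4 * ∑ i, u i ^ 2 + 16 * u 0 * u 1 * u 2

/-- `X_i(x) = ((1 - 4 u_i^2) x_i - 2 ∑_{j ≠ i} (u_k - 2 u_i u_j) x_j) / √(Δ (1 - 4 u_i^2))`, where
`{i, j, k} = {1, 2, 3}`. Index addition is modulo three, so that the two values of `j` are
`i + 1` (with `k = i + 2`) and `i + 2` (with `k = i + 1`). -/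
def argX (u : Fin 3 → ℝ) (i : Fin 3) (x : Fin 3 → ℝ) : ℝ :=
  ((1 - 4 * u i ^ 2) * x i
      - 2 * ((u (i + 2) - 2 * u i * u (i + 1)) * x (i + 1)
        + (u (i + 1) - 2 * u i * u (i + 2)) * x (i + 2)))
    / √(discr u * (1 - 4 * u i ^ 2))

/-- The exponent of Carlitz's formula. The two sums over pairs are over unordered pairs of
distinct indices; in the first one, `i` is the index that is missing from the pair. -/
def carlitzExponent (u x : Fin 3 → ℝ) : ℝ :=
  ∑ i, x i ^ 2
    - (∑ i, x i ^ 2 - 4 * ∑ i, x i ^ 2 * u i ^ 2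
        - 4 * ∑ i : Fin 3, x (i + 1) * x (i + 2) * u i
        + 8 * ∑ i : Fin 3, u i * u (i + 1) * x i * x (i + 1)) / discr u

/-- The finite index set `Λ_3` of the pairs `(k_1, k_2)` with `k_1 ≤ min {r_1, r_2}` and
`k_2 ≤ min {r_3, r_1 + r_2 - 2 k_1}`. -/
def indexSet (r : Fin 3 → ℕ) : Finset (ℕ × ℕ) :=
  {k ∈ Finset.range (min (r 0) (r 1) + 1) ×ˢ Finset.range (r 2 + 1) | k.2 + 2 * k.1 ≤ r 0 + r 1}

/-- The nested expression
`H_{r_3-k_2}(X_3(x)) D_3^{k_2} [H_{r_2-k_1}(X_2(x)) D_2^{k_1} H_{r_1}(X_1(x))]`. -/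
def nestedTerm (u : Fin 3 → ℝ) (r : Fin 3 → ℕ) (k : ℕ × ℕ) (x : Fin 3 → ℝ) : ℝ :=
  hermiteH (r 2 - k.2) (argX u 2 x) *
    (pderiv 2)^[k.2] (fun y => hermiteH (r 1 - k.1) (argX u 1 y) *
      (pderiv 1)^[k.1] (fun z => hermiteH (r 0) (argX u 0 z)) y) x

/-- The scalar and binomial weight of the term with index `(k_1, k_2)`:
`∏_{i=1}^{2} (-√(Δ / (1 - 4 u_{i+1}^2)))^{k_i} binom(r_{i+1}, k_i)`. -/
def weight (u : Fin 3 → ℝ) (r : Fin 3 → ℕ) (k : ℕ × ℕ) : ℝ :=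
  ((-√(discr u / (1 - 4 * u 1 ^ 2))) ^ k.1 * ((r 1).choose k.1 : ℝ)) *
    ((-√(discr u / (1 - 4 * u 2 ^ 2))) ^ k.2 * ((r 2).choose k.2 : ℝ))

end CarlitzMehler

end

/-! Let A be the symmetric matrix with unit diagonal and off-diagonal entries 2u_k; its determinant
is Δ. Up to a constant, H_s(x) e^{-x²} is the Fourier integral of (-iξ)^s e^{-ξ²/4}. After
multiplication by e^{-|x|²}, the term with index (m, n, p) therefore has as symbol the fixed
monomial ∏(-iξ_i)^{r_i} times e^{-|ξ|²/4} times (-u_1ξ_2ξ_3)^m (-u_2ξ_1ξ_3)^n (-u_3ξ_1ξ_2)^p / (m!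
n! p!). The sum of these is an exponential series, and the total symbol is ∏(-iξ_i)^{r_i}
e^{-ξᵀAξ/4} (`hasSum_symbol`).

Summation and integration commute by dominated convergence: the sum of the norms is again a monomial
times a Gaussian, now with -|u_k| in place of u_k, and the smallness condition on u is what makes
that form coercive (`IsSubcritical.exists_lower_bound`).

The integral of the total symbol is a signed mixed derivative of (2√π)³ Δ^{-1/2} e^{-xᵀA⁻¹x}
(`fourierGauss_eq_pderiv`). Along the i-th axis this Gaussian is a one-variable Gaussian in X_i =
(A⁻¹x)_i / √((A⁻¹)_{ii}), so D_i^n produces H_n(X_i) (`pderiv_iterate_gauss`). Applying D_1, D_2,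
D_3 in turn with the Leibniz rule gives the nested finite sum (`pderiv_gauss_eq_sum`); the pairs
outside Λ_3 contribute zero for degree reasons. -/

noncomputable section

namespace CarlitzMehler

section Derivatives

open scoped ContDiff
open Polynomial

/-! ### Hermite polynomials -/

/-- The Hermite polynomials, by their three-term differential recursion. -/
def hermitePoly : ℕ → ℝ[X]
  | 0 => 1
  | n + 1 => 2 * X * hermitePoly n - derivative (hermitePoly n)

theorem natDegree_hermitePoly_le (n : ℕ) : (hermitePoly n).natDegree ≤ n := by
  induction n with
  | zero => simp [hermitePoly]
  | succ n ih =>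
    refine (natDegree_sub_le _ _).trans (max_le ?_ ?_)
    · have h2 : (2 * X : ℝ[X]).natDegree ≤ 1 := by
        simp
      exact natDegree_mul_le.trans (by omega)
    · exact (natDegree_derivative_le _).trans (by omega)

theorem iteratedDeriv_exp_neg_sq (n : ℕ) :
    iteratedDeriv n (fun y : ℝ => Real.exp (-y ^ 2)) =
      fun y => (-1) ^ n * (hermitePoly n).eval y * Real.exp (-y ^ 2) := by
  induction n with
  | zero => simp [hermitePoly]
  | succ n ih =>
    rw [iteratedDeriv_succ, ih]
    ext y
    have h : HasDerivAt (fun y : ℝ => Real.exp (-y ^ 2)) (Real.exp (-y ^ 2) * (-(2 * y))) y := by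
      simpa using ((hasDerivAt_pow 2 y).neg).exp
    refine ((((hermitePoly n).hasDerivAt y).const_mul ((-1) ^ n)).mul h).deriv.trans ?_
    simp only [hermitePoly, eval_sub, eval_mul, eval_ofNat, eval_X]
    ring

theorem hermiteH_eq_eval (n : ℕ) (x : ℝ) : hermiteH n x = (hermitePoly n).eval x := by
  have h : Real.exp (x ^ 2) * Real.exp (-x ^ 2) = 1 := by rw [← Real.exp_add]; simp
  have h1 : ((-1 : ℝ) ^ n) * (-1) ^ n = 1 := by rw [← mul_pow]; simp
  rw [hermiteH, iteratedDeriv_exp_neg_sq]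
  linear_combination (hermitePoly n).eval x * (Real.exp (x ^ 2) * Real.exp (-x ^ 2) * h1 + h)

/-! ### Iterated partial derivatives -/

/-- Updating one coordinate twice keeps only the last value, so everything happens on a single line.
This transfers the one-variable rules for iterated derivatives to `pderiv`. -/
theorem pderiv_iterate_apply (i : Fin 3) (n : ℕ) (f : (Fin 3 → ℝ) → ℝ) (x : Fin 3 → ℝ) :
    (pderiv i)^[n] f x = iteratedDeriv n (fun t => f (Function.update x i t)) (x i) := by
  induction n generalizing x with
  | zero => simp
  | succ n ih =>
    rw [Function.iterate_succ_apply', iteratedDeriv_succ, pderiv]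
    congr 1
    ext t
    simp [ih]

theorem pderiv_eq_fderiv {f : (Fin 3 → ℝ) → ℝ} (hf : Differentiable ℝ f) (i : Fin 3) :
    pderiv i f = fun x => fderiv ℝ f x (Pi.single i 1) := by
  ext x
  have h := (hf (Function.update x i (x i))).hasFDerivAt.comp_hasDerivAt (x i)
    (hasDerivAt_update x i (x i))
  rw [Function.update_eq_self] at h
  exact h.deriv

theorem contDiff_pderiv_iterate {f : (Fin 3 → ℝ) → ℝ} (hf : ContDiff ℝ ∞ f) (i : Fin 3) (n : ℕ) :
    ContDiff ℝ ∞ ((pderiv i)^[n] f) := by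
  induction n with
  | zero => exact hf
  | succ n ih =>
    rw [Function.iterate_succ_apply', pderiv_eq_fderiv (ih.differentiable (by simp))]
    exact (ih.fderiv_right (by simp)).clm_apply contDiff_const

theorem pderiv_iterate_const_mul (i : Fin 3) (n : ℕ) (c : ℝ) (f : (Fin 3 → ℝ) → ℝ) :
    (pderiv i)^[n] (fun y => c * f y) = fun y => c * (pderiv i)^[n] f y := by
  ext x
  simp only [pderiv_iterate_apply, iteratedDeriv_const_mul_field]

theorem pderiv_iterate_invariant_mul {i : Fin 3} {f : (Fin 3 → ℝ) → ℝ}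
    (hf : ∀ x t, f (Function.update x i t) = f x) (n : ℕ) (g : (Fin 3 → ℝ) → ℝ) :
    (pderiv i)^[n] (fun y => f y * g y) = fun y => f y * (pderiv i)^[n] g y := by
  ext x
  simp only [pderiv_iterate_apply, hf, iteratedDeriv_const_mul_field]

theorem contDiff_slice {f : (Fin 3 → ℝ) → ℝ} (hf : ContDiff ℝ ∞ f) (i : Fin 3) (x : Fin 3 → ℝ) :
    ContDiff ℝ ∞ (fun t => f (Function.update x i t)) :=
  hf.comp (contDiff_update _ x i)

theorem pderiv_iterate_mul {f g : (Fin 3 → ℝ) → ℝ} (hf : ContDiff ℝ ∞ f) (hg : ContDiff ℝ ∞ g)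
    (i : Fin 3) (n : ℕ) :
    (pderiv i)^[n] (fun y => f y * g y) = fun y => ∑ k ∈ Finset.range (n + 1),
      (n.choose k : ℝ) * (pderiv i)^[k] f y * (pderiv i)^[n - k] g y := by
  ext x
  simp only [pderiv_iterate_apply]
  exact iteratedDeriv_fun_mul
    ((contDiff_slice hf i x).contDiffAt.of_le (by exact_mod_cast le_top))
    ((contDiff_slice hg i x).contDiffAt.of_le (by exact_mod_cast le_top))

theorem pderiv_iterate_sum {ι : Type*} (s : Finset ι) {f : ι → (Fin 3 → ℝ) → ℝ}
    (hf : ∀ k ∈ s, ContDiff ℝ ∞ (f k)) (i : Fin 3) (n : ℕ) :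
    (pderiv i)^[n] (fun y => ∑ k ∈ s, f k y) = fun y => ∑ k ∈ s, (pderiv i)^[n] (f k) y := by
  ext x
  simp only [pderiv_iterate_apply]
  exact iteratedDeriv_fun_sum fun k hk =>
    (contDiff_slice (hf k hk) i x).contDiffAt.of_le (by exact_mod_cast le_top)

/-! ### Polynomials in affine functions -/

theorem argX_update (u : Fin 3 → ℝ) (i j : Fin 3) (x : Fin 3 → ℝ) (t : ℝ) :
    argX u i (Function.update x j t) = argX u i x + (t - x j) * argX u i (Pi.single j 1) := by
  have h : Function.update x j t = x + (t - x j) • Pi.single j 1 := by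
    ext k
    by_cases hk : k = j
    · subst hk; simp
    · simp [hk]
  rw [h]
  simp only [argX, Pi.add_apply, Pi.smul_apply, smul_eq_mul]
  ring

theorem contDiff_argX (u : Fin 3 → ℝ) (i : Fin 3) : ContDiff ℝ ∞ (argX u i) := by
  unfold argX
  fun_prop

theorem contDiff_eval_argX (u : Fin 3 → ℝ) (i : Fin 3) (p : ℝ[X]) :
    ContDiff ℝ ∞ (fun y => p.eval (argX u i y)) := by
  have h : ContDiff ℝ ∞ (fun y : ℝ => p.eval y) := by
    simpa [Polynomial.coe_aeval_eq_eval] using p.contDiff_aeval (𝕜 := ℝ) ∞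
  exact h.comp (contDiff_argX u i)

theorem iteratedDeriv_eval (p : ℝ[X]) (n : ℕ) :
    iteratedDeriv n (fun t => p.eval t) = fun t => (derivative^[n] p).eval t := by
  induction n with
  | zero => simp
  | succ n ih =>
    rw [iteratedDeriv_succ, ih, Function.iterate_succ_apply']
    ext t
    simp

theorem eval_argX_update (u : Fin 3 → ℝ) (i j : Fin 3) (p : ℝ[X]) (x : Fin 3 → ℝ) (t : ℝ) :
    p.eval (argX u i (Function.update x j t)) = (p.comp (C (argX u i (Pi.single j 1)) * X +
      C (argX u i x - x j * argX u i (Pi.single j 1)))).eval t := by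
  rw [argX_update, eval_comp]
  congr 1
  simp
  ring

theorem natDegree_comp_linear_le (p : ℝ[X]) (a b : ℝ) :
    (p.comp (C a * X + C b)).natDegree ≤ p.natDegree := by
  refine natDegree_comp_le.trans ?_
  calc _ ≤ p.natDegree * 1 := Nat.mul_le_mul_left _ (natDegree_linear_le)
    _ = _ := mul_one _

theorem pderiv_iterate_eval_argX (u : Fin 3 → ℝ) (i j : Fin 3) (p : ℝ[X]) (n : ℕ) :
    (pderiv j)^[n] (fun y => p.eval (argX u i y)) =
      fun y => (C (argX u i (Pi.single j 1) ^ n) * derivative^[n] p).eval (argX u i y) := by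
  induction n with
  | zero => simp
  | succ n ih =>
    rw [Function.iterate_succ_apply', ih, Function.iterate_succ_apply']
    ext x
    set q := derivative^[n] p
    set a := argX u i (Pi.single j 1)
    have h1 : HasDerivAt (fun t => argX u i (Function.update x j t)) a (x j) := by
      have : (fun t => argX u i (Function.update x j t)) =
          fun t => argX u i x + (t - x j) * a := funext fun t => argX_update u i j x t
      rw [this]
      simpa using (((hasDerivAt_id (x j)).sub_const (x j)).mul_const a).const_add (argX u i x)
    have h2 := ((C (a ^ n) * q).hasDerivAt (argX u i (Function.update x j (x j)))).comp (x j) h1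
    rw [pderiv]
    refine h2.deriv.trans ?_
    simp only [Function.update_eq_self, derivative_C_mul, eval_mul, eval_C, pow_succ]
    ring

/-- On a line parallel to the j-th axis both factors are polynomials composed with affine functions,
so the product is a polynomial of degree below n. -/
theorem pderiv_iterate_eval_mul_eq_zero (u : Fin 3 → ℝ) (i i' j : Fin 3) (p q : ℝ[X]) {n : ℕ}
    (h : p.natDegree + q.natDegree < n) (x : Fin 3 → ℝ) :
    (pderiv j)^[n] (fun y => p.eval (argX u i y) * q.eval (argX u i' y)) x = 0 := by
  rw [pderiv_iterate_apply]
  simp only [eval_argX_update, ← eval_mul]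
  rw [iteratedDeriv_eval, iterate_derivative_eq_zero]
  · exact eval_zero
  refine lt_of_le_of_lt (natDegree_mul_le.trans ?_) h
  exact add_le_add (natDegree_comp_linear_le _ _ _) (natDegree_comp_linear_le _ _ _)

/-- This is where the shape of Λ_3 comes from: the differentiated factor has degree at most r_1 -
k_1 and its partner at most r_2 - k_1. The bound k_1 ≤ r_2 keeps the natural subtraction from
truncating. -/
theorem nestedTerm_eq_zero (u : Fin 3 → ℝ) (r : Fin 3 → ℕ) {k : ℕ × ℕ} (h1 : k.1 ≤ r 1)
    (h : r 0 < k.1 ∨ r 0 + r 1 < k.2 + 2 * k.1) (x : Fin 3 → ℝ) :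
    nestedTerm u r k x = 0 := by
  simp only [nestedTerm, hermiteH_eq_eval, pderiv_iterate_eval_argX]
  refine mul_eq_zero_of_right _ ?_
  by_cases h0 : r 0 < k.1
  · have hz : derivative^[k.1] (hermitePoly (r 0)) = 0 :=
      iterate_derivative_eq_zero ((natDegree_hermitePoly_le _).trans_lt h0)
    rw [hz, pderiv_iterate_apply]
    simp
  · apply pderiv_iterate_eval_mul_eq_zero
    have hd : (derivative^[k.1] (hermitePoly (r 0))).natDegree ≤ r 0 - k.1 :=
      (natDegree_iterate_derivative _ _).trans
        (Nat.sub_le_sub_right (natDegree_hermitePoly_le _) _)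
    have hd' := natDegree_C_mul_le (argX u 0 (Pi.single 1 1) ^ k.1)
      (derivative^[k.1] (hermitePoly (r 0)))
    have := natDegree_hermitePoly_le (r 1 - k.1)
    omega

/-! ### The Gaussian -/

/-- The quadratic form of the matrix inverse to the one with unit diagonal and entries `2 u_k`. -/
def invForm (u x : Fin 3 → ℝ) : ℝ :=
  (∑ i, x i ^ 2 - 4 * ∑ i, x i ^ 2 * u i ^ 2
        - 4 * ∑ i : Fin 3, x (i + 1) * x (i + 2) * u i
        + 8 * ∑ i : Fin 3, u i * u (i + 1) * x i * x (i + 1)) / discr u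

/-- The Gaussian with quadratic form `invForm u`. -/
def gauss (u x : Fin 3 → ℝ) : ℝ := Real.exp (-invForm u x)

/-- The square root of the `i`-th diagonal coefficient of `invForm u`. -/
def scale (u : Fin 3 → ℝ) (i : Fin 3) : ℝ := √((1 - 4 * u i ^ 2) / discr u)

theorem contDiff_gauss (u : Fin 3 → ℝ) : ContDiff ℝ ∞ (gauss u) := by
  unfold gauss invForm
  fun_prop

/-- The right side is (A⁻¹x)_i, half the i-th partial derivative of `invForm u`; the product is free
of square roots. -/
theorem scale_mul_argX {u : Fin 3 → ℝ} {i : Fin 3} (hD : 0 < discr u) (hi : 0 < 1 - 4 * u i ^ 2)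
    (x : Fin 3 → ℝ) :
    scale u i * argX u i x = ((1 - 4 * u i ^ 2) * x i
      - 2 * ((u (i + 2) - 2 * u i * u (i + 1)) * x (i + 1)
        + (u (i + 1) - 2 * u i * u (i + 2)) * x (i + 2))) / discr u := by
  have h1 : scale u i / √(discr u * (1 - 4 * u i ^ 2)) = 1 / discr u := by
    rw [scale, ← Real.sqrt_div' _ (by positivity),
      show (1 - 4 * u i ^ 2) / discr u / (discr u * (1 - 4 * u i ^ 2)) = (1 / discr u) ^ 2 by
        field_simp, Real.sqrt_sq (by positivity)]
  rw [argX, mul_div_assoc', mul_comm, mul_div_assoc, h1]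
  ring

theorem argX_single {u : Fin 3 → ℝ} {i : Fin 3} (hi : 0 < 1 - 4 * u i ^ 2) :
    argX u i (Pi.single i 1) = scale u i := by
  have h1 : i + 1 ≠ i := by fin_cases i <;> decide
  have h2 : i + 2 ≠ i := by fin_cases i <;> decide
  rw [scale, argX]
  simp only [Pi.single_eq_same, Pi.single_eq_of_ne h1, Pi.single_eq_of_ne h2]
  rw [mul_comm (discr u), Real.sqrt_mul hi.le, Real.sqrt_div hi.le]
  have := Real.sq_sqrt hi.le
  have h3 := (Real.sqrt_pos.2 hi).ne'
  -- Positivity of Δ is not needed here: if the root vanishes, both sides are quotients by zero,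
  -- hence zero.
  by_cases hD : √(discr u) = 0
  · simp [hD]
  · field_simp
    linarith

theorem invForm_update {u : Fin 3 → ℝ} {i : Fin 3} (hD : 0 < discr u) (hi : 0 < 1 - 4 * u i ^ 2)
    (x : Fin 3 → ℝ) (t : ℝ) :
    invForm u (Function.update x i t) = invForm u x + 2 * (scale u i * argX u i x) * (t - x i)
      + (1 - 4 * u i ^ 2) / discr u * (t - x i) ^ 2 := by
  rw [scale_mul_argX hD hi]
  simp only [invForm, Fin.sum_univ_three]
  have := hD.ne'
  field_simp
  fin_cases i <;> simp [Function.update] <;> ring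

theorem hasDerivAt_gauss {u : Fin 3 → ℝ} {i : Fin 3} (hD : 0 < discr u) (hi : 0 < 1 - 4 * u i ^ 2)
    (x : Fin 3 → ℝ) :
    HasDerivAt (fun t => gauss u (Function.update x i t))
      (-(2 * (scale u i * argX u i x)) * gauss u x) (x i) := by
  have h : HasDerivAt (fun t => invForm u (Function.update x i t))
      (2 * (scale u i * argX u i x)) (x i) := by
    rw [show (fun t => invForm u (Function.update x i t)) = _ from
      funext fun t => invForm_update hD hi x t]
    have h1 := (hasDerivAt_id (x i)).sub_const (x i)
    refine (((h1.const_mul (2 * (scale u i * argX u i x))).const_add (invForm u x)).add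
      ((h1.pow 2).const_mul ((1 - 4 * u i ^ 2) / discr u))).congr_deriv ?_
    simp
  refine h.fun_neg.exp.congr_deriv ?_
  rw [Function.update_eq_self, gauss, mul_comm]

/-- Differentiating the Gaussian gives the factor -2 `scale` X_i and differentiating X_i gives
`scale`, so each step reproduces the recursion H_{n+1} = 2X H_n - H_n' with an extra factor
-`scale`. -/
theorem pderiv_iterate_gauss {u : Fin 3 → ℝ} {i : Fin 3} (hD : 0 < discr u)
    (hi : 0 < 1 - 4 * u i ^ 2) (n : ℕ) :
    (pderiv i)^[n] (gauss u) =
      fun y => (-scale u i) ^ n * (hermiteH n (argX u i y) * gauss u y) := by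
  induction n with
  | zero => simp [hermiteH_eq_eval, hermitePoly]
  | succ n ih =>
    rw [Function.iterate_succ_apply', ih]
    ext x
    simp only [hermiteH_eq_eval]
    have h1 : HasDerivAt (fun t => argX u i (Function.update x i t)) (scale u i) (x i) := by
      rw [show (fun t => argX u i (Function.update x i t)) = _ from
        funext fun t => argX_update u i i x t, argX_single hi]
      simpa using
        (((hasDerivAt_id (x i)).sub_const (x i)).mul_const (scale u i)).const_add (argX u i x)
    have h2 := ((hermitePoly n).hasDerivAt (argX u i (Function.update x i (x i)))).comp (x i) h1
    refine ((h2.mul (hasDerivAt_gauss hD hi x)).const_mul ((-scale u i) ^ n)).deriv.trans ?_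
    simp [hermitePoly]
    ring

/-- The expansion of a mixed derivative of the Gaussian into products of Hermite polynomials. -/
theorem pderiv_gauss_eq_sum {u : Fin 3 → ℝ} (hD : 0 < discr u) (hi : ∀ i, 0 < 1 - 4 * u i ^ 2)
    (r : Fin 3 → ℕ) (x : Fin 3 → ℝ) :
    (pderiv 2)^[r 2] ((pderiv 1)^[r 1] ((pderiv 0)^[r 0] (gauss u))) x =
      (∏ i, (-scale u i) ^ r i) * gauss u x *
        ∑ k ∈ indexSet r, weight u r k * nestedTerm u r k x := by
  have hH : ∀ n i, ContDiff ℝ ∞ (fun y => hermiteH n (argX u i y)) := fun n i => by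
    simpa only [hermiteH_eq_eval] using contDiff_eval_argX u i (hermitePoly n)
  have hs : ∀ i, scale u i ≠ 0 := fun i => (Real.sqrt_pos.2 (div_pos (hi i) hD)).ne'
  have hinv : ∀ i, -√(discr u / (1 - 4 * u i ^ 2)) = (-scale u i)⁻¹ := fun i => by
    rw [scale, inv_neg, ← Real.sqrt_inv, inv_div]
  have hg := contDiff_gauss u
  set f : ℕ → (Fin 3 → ℝ) → ℝ := fun k y => hermiteH (r 1 - k) (argX u 1 y) *
      (pderiv 1)^[k] (fun z => hermiteH (r 0) (argX u 0 z)) y with hf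
  have hfs : ∀ k, ContDiff ℝ ∞ (f k) := fun k =>
    (hH _ _).mul (contDiff_pderiv_iterate (hH _ _) _ _)
  -- Leibniz: k derivatives fall on H_{r_1}(X_1), and the other r_2 - k fall on the Gaussian and
  -- create H_{r_2-k}(X_2).
  have e1 : (pderiv 1)^[r 1] ((pderiv 0)^[r 0] (gauss u)) = fun y =>
      ∑ k ∈ Finset.range (r 1 + 1), ((-scale u 0) ^ r 0 * (r 1).choose k *
        (-scale u 1) ^ (r 1 - k)) * (f k y * gauss u y) := by
    rw [pderiv_iterate_gauss hD (hi 0), pderiv_iterate_const_mul, pderiv_iterate_mul (hH _ _) hg]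
    ext y
    rw [Finset.mul_sum]
    refine Finset.sum_congr rfl fun k _ => ?_
    rw [pderiv_iterate_gauss hD (hi 1)]
    simp only [hf]
    ring
  have hsub : indexSet r ⊆ Finset.range (r 1 + 1) ×ˢ Finset.range (r 2 + 1) := by
    intro k
    simp only [indexSet, Finset.mem_filter, Finset.mem_product, Finset.mem_range]
    omega
  rw [e1, pderiv_iterate_sum _ fun k _ => contDiff_const.mul ((hfs k).mul hg)]
  -- The sum over Λ_3 is enlarged to the full Leibniz rectangle; the added terms vanish by
  -- `nestedTerm_eq_zero`.
  rw [Finset.sum_subset hsub, Finset.sum_product, Finset.mul_sum]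
  · refine Finset.sum_congr rfl fun k hk => ?_
    rw [pderiv_iterate_const_mul, pderiv_iterate_mul (hfs k) hg]
    beta_reduce
    simp only [Finset.mul_sum]
    refine Finset.sum_congr rfl fun l hl => ?_
    rw [pderiv_iterate_gauss hD (hi 2)]
    have hk' : k ≤ r 1 := by simpa [Nat.lt_succ_iff] using hk
    have hl' : l ≤ r 2 := by simpa [Nat.lt_succ_iff] using hl
    simp only [weight, nestedTerm, hinv, Fin.prod_univ_three]
    -- Splitting off the inverse powers of -`scale` yields the factors -√(Δ/(1-4u²)) in `weight`.
    rw [pow_sub₀ _ (neg_ne_zero.2 (hs 1)) hk', pow_sub₀ _ (neg_ne_zero.2 (hs 2)) hl']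
    simp only [inv_pow, hf]
    ring
  · intro k hk hk'
    simp only [indexSet, Finset.mem_filter, Finset.mem_product, Finset.mem_range] at hk hk'
    rw [nestedTerm_eq_zero u r (by omega) (by omega), mul_zero]

end Derivatives

open scoped Nat
open MeasureTheory

/-! ### Coercivity -/

/-- One quarter of the quadratic form with unit diagonal and off-diagonal entries `2 u_k`. -/
def quadForm (u ξ : Fin 3 → ℝ) : ℝ :=
  (1 / 4) * ∑ i, ξ i ^ 2 + (u 0 * (ξ 1 * ξ 2) + u 1 * (ξ 0 * ξ 2) + u 2 * (ξ 0 * ξ 1))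

/-- The condition that the matrix with zero diagonal and entries `2 |u_k|` has norm below one. -/
def IsSubcritical (u : Fin 3 → ℝ) : Prop := 4 * ∑ i, u i ^ 2 + 16 * |u 0 * u 1 * u 2| < 1

theorem IsSubcritical.one_sub_pos {u : Fin 3 → ℝ} (hu : IsSubcritical u) (i : Fin 3) :
    0 < 1 - 4 * u i ^ 2 := by
  have h : u i ^ 2 ≤ ∑ i, u i ^ 2 :=
    Finset.single_le_sum (f := fun i => u i ^ 2) (fun _ _ => sq_nonneg _) (Finset.mem_univ i)
  have := abs_nonneg (u 0 * u 1 * u 2)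
  unfold IsSubcritical at hu
  linarith

theorem IsSubcritical.discr_pos {u : Fin 3 → ℝ} (hu : IsSubcritical u) : 0 < discr u := by
  have := neg_abs_le (u 0 * u 1 * u 2)
  unfold IsSubcritical at hu
  unfold discr
  linarith

theorem isSubcritical_zero : IsSubcritical 0 := by simp [IsSubcritical]

/-- Completing squares: the hypotheses say that the matrix with unit diagonal and off-diagonal
entries -2p, -2q, -2r has nonnegative determinant and positive second leading minor. -/
theorem ternary_form_nonneg {p q r : ℝ}
    (h : 4 * (p ^ 2 + q ^ 2 + r ^ 2) + 16 * (p * q * r) ≤ 1)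
    (hr : 4 * r ^ 2 < 1) (a b c : ℝ) :
    0 ≤ a ^ 2 + b ^ 2 + c ^ 2 - 4 * (p * (b * c) + q * (a * c) + r * (a * b)) := by
  have hd : 0 < 1 - 4 * r ^ 2 := by linarith
  have key : (1 - 4 * r ^ 2) *
      (a ^ 2 + b ^ 2 + c ^ 2 - 4 * (p * (b * c) + q * (a * c) + r * (a * b))) =
      (1 - 4 * r ^ 2) * (a - 2 * q * c - 2 * r * b) ^ 2
        + ((1 - 4 * r ^ 2) * b - (2 * p + 4 * q * r) * c) ^ 2
        + (1 - (4 * (p ^ 2 + q ^ 2 + r ^ 2) + 16 * (p * q * r))) * c ^ 2 := by ring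
  refine nonneg_of_mul_nonneg_right (a := 1 - 4 * r ^ 2) ?_ hd
  rw [key]
  have : 0 ≤ 1 - (4 * (p ^ 2 + q ^ 2 + r ^ 2) + 16 * (p * q * r)) := by linarith
  positivity

theorem IsSubcritical.exists_lower_bound {u : Fin 3 → ℝ} (hu : IsSubcritical u) :
    ∃ δ > 0, ∀ ξ : Fin 3 → ℝ, δ * ∑ i, ξ i ^ 2 ≤ (1 / 4) * ∑ i, ξ i ^ 2
      - (|u 0| * (|ξ 1| * |ξ 2|) + |u 1| * (|ξ 0| * |ξ 2|) + |u 2| * (|ξ 0| * |ξ 1|)) := by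
  set κ := 4 * ∑ i, u i ^ 2 + 16 * |u 0 * u 1 * u 2| with hκ
  have hκ1 : κ < 1 := hu
  have hκ0 : 0 ≤ κ := by positivity
  -- By the AM-GM inequality for 1, 1, κ, this s satisfies κ ≤ s³, while s < 1. Hence |u|/s still
  -- satisfies the hypotheses of `ternary_form_nonneg`, and the slack 1 - s gives the coercivity
  -- constant.
  set s := (2 + κ) / 3 with hs
  have hs0 : 0 < s := by linarith
  have hs1 : s < 1 := by linarith
  have hs3 : κ ≤ s ^ 3 := by
    have : s ^ 3 - κ = (κ - 1) ^ 2 * (κ + 8) / 27 := by rw [hs]; ring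
    have h2 : 0 ≤ (κ - 1) ^ 2 * (κ + 8) / 27 := by positivity
    linarith
  have hsum : ∑ i, u i ^ 2 = |u 0| ^ 2 + |u 1| ^ 2 + |u 2| ^ 2 := by
    simp [Fin.sum_univ_three]
  have habs : |u 0 * u 1 * u 2| = |u 0| * |u 1| * |u 2| := by simp [abs_mul]
  have hh : 4 * ((|u 0| / s) ^ 2 + (|u 1| / s) ^ 2 + (|u 2| / s) ^ 2)
      + 16 * (|u 0| / s * (|u 1| / s) * (|u 2| / s)) ≤ 1 := by
    have e : 4 * ((|u 0| / s) ^ 2 + (|u 1| / s) ^ 2 + (|u 2| / s) ^ 2)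
      + 16 * (|u 0| / s * (|u 1| / s) * (|u 2| / s))
      = (s * (4 * ∑ i, u i ^ 2) + 16 * |u 0 * u 1 * u 2|) / s ^ 3 := by
      rw [hsum, habs]
      field_simp
    rw [e, div_le_one (by positivity)]
    have h4 : s * (4 * ∑ i, u i ^ 2) ≤ 1 * (4 * ∑ i, u i ^ 2) :=
      mul_le_mul_of_nonneg_right hs1.le (by positivity)
    linarith
  have hr : 4 * (|u 2| / s) ^ 2 < 1 := by
    rw [div_pow, ← mul_div_assoc, div_lt_one (by positivity), sq_abs]
    have h2 : u 2 ^ 2 ≤ ∑ i, u i ^ 2 := Finset.single_le_sum (f := fun i => u i ^ 2)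
      (fun _ _ => sq_nonneg _) (Finset.mem_univ 2)
    have h3 := abs_nonneg (u 0 * u 1 * u 2)
    have h5 : s ^ 2 - κ = (1 - κ) * (4 - κ) / 9 := by rw [hs]; ring
    have h6 : 0 < (1 - κ) * (4 - κ) / 9 :=
      div_pos (mul_pos (by linarith) (by linarith)) (by norm_num)
    linarith
  refine ⟨(1 - s) / 4, by linarith, fun ξ => ?_⟩
  have h := ternary_form_nonneg hh hr (|ξ 0|) (|ξ 1|) (|ξ 2|)
  have hξ : ∑ i, ξ i ^ 2 = |ξ 0| ^ 2 + |ξ 1| ^ 2 + |ξ 2| ^ 2 := by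
    simp [Fin.sum_univ_three]
  have h' := mul_nonneg hs0.le h
  have e : s * (|ξ 0| ^ 2 + |ξ 1| ^ 2 + |ξ 2| ^ 2 - 4 * (|u 0| / s * (|ξ 1| * |ξ 2|)
      + |u 1| / s * (|ξ 0| * |ξ 2|) + |u 2| / s * (|ξ 0| * |ξ 1|)))
      = s * (|ξ 0| ^ 2 + |ξ 1| ^ 2 + |ξ 2| ^ 2) - 4 * (|u 0| * (|ξ 1| * |ξ 2|)
      + |u 1| * (|ξ 0| * |ξ 2|) + |u 2| * (|ξ 0| * |ξ 1|)) := by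
    field_simp
  rw [e] at h'
  rw [hξ]
  linarith

theorem integrable_pow_mul_exp_neg_mul_sq {δ : ℝ} (hδ : 0 < δ) (n : ℕ) :
    Integrable fun x : ℝ => |x| ^ n * Real.exp (-δ * x ^ 2) := by
  have h := (integrable_rpow_mul_exp_neg_mul_sq hδ (s := n)
    (by have := n.cast_nonneg (α := ℝ); linarith)).norm
  simpa [abs_mul, Real.rpow_natCast] using h

/-- The absolute value of a monomial. -/
def absMonomial (r : Fin 3 → ℕ) (ξ : Fin 3 → ℝ) : ℝ := ∏ i, |ξ i| ^ r i

theorem integrable_absMonomial_mul_exp {u : Fin 3 → ℝ} (hu : IsSubcritical u) (r : Fin 3 → ℕ) :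
    Integrable fun ξ : Fin 3 → ℝ => absMonomial r ξ * Real.exp (-((1 / 4) * ∑ i, ξ i ^ 2
      - (|u 0| * (|ξ 1| * |ξ 2|) + |u 1| * (|ξ 0| * |ξ 2|) + |u 2| * (|ξ 0| * |ξ 1|)))) := by
  obtain ⟨δ, hδ, h⟩ := hu.exists_lower_bound
  have hint : Integrable fun ξ : Fin 3 → ℝ => ∏ i, (|ξ i| ^ r i * Real.exp (-δ * ξ i ^ 2)) :=
    Integrable.fintype_prod (f := fun i (v : ℝ) => |v| ^ r i * Real.exp (-δ * v ^ 2))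
      fun i => integrable_pow_mul_exp_neg_mul_sq hδ (r i)
  refine hint.mono' (Continuous.aestronglyMeasurable (by unfold absMonomial; fun_prop))
    (Filter.Eventually.of_forall fun ξ => ?_)
  have h0 : 0 ≤ absMonomial r ξ := Finset.prod_nonneg fun i _ => by positivity
  rw [Real.norm_of_nonneg (mul_nonneg h0 (Real.exp_pos _).le), Finset.prod_mul_distrib,
    ← Real.exp_sum, ← Finset.mul_sum]
  refine mul_le_mul_of_nonneg_left (Real.exp_le_exp.2 ?_) h0
  linarith [h ξ]

/-! ### The Fourier integral -/

/-- A monomial in `-I ξ` times a Gaussian, the Fourier transform of a derivative of a Gaussian. -/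
def symbol (u : Fin 3 → ℝ) (r : Fin 3 → ℕ) (ξ : Fin 3 → ℝ) : ℂ :=
  (∏ i, (-(Complex.I * ξ i)) ^ r i) * Complex.exp (-(quadForm u ξ : ℂ))

/-- The plane wave with frequency `ξ`. -/
def wave (x ξ : Fin 3 → ℝ) : ℂ := Complex.exp (Complex.I * ((∑ i, x i * ξ i : ℝ) : ℂ))

/-- The real part of the inverse Fourier transform of `symbol u r`. -/
def fourierGauss (u : Fin 3 → ℝ) (r : Fin 3 → ℕ) (x : Fin 3 → ℝ) : ℝ :=
  (∫ ξ, symbol u r ξ * wave x ξ).re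

theorem norm_wave (x ξ : Fin 3 → ℝ) : ‖wave x ξ‖ = 1 := by
  rw [wave, mul_comm, Complex.norm_exp_ofReal_mul_I]

theorem norm_symbol (u : Fin 3 → ℝ) (r : Fin 3 → ℕ) (ξ : Fin 3 → ℝ) :
    ‖symbol u r ξ‖ = absMonomial r ξ * Real.exp (-quadForm u ξ) := by
  rw [symbol, norm_mul, norm_prod, ← Complex.ofReal_neg, Complex.norm_exp_ofReal]
  simp [absMonomial]

theorem continuous_symbol (u : Fin 3 → ℝ) (r : Fin 3 → ℕ) : Continuous (symbol u r) := by
  unfold symbol quadForm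
  fun_prop

theorem continuous_wave (x : Fin 3 → ℝ) : Continuous (wave x) := by
  unfold wave
  fun_prop

theorem lower_bound_quadForm (u ξ : Fin 3 → ℝ) :
    (1 / 4) * ∑ i, ξ i ^ 2 - (|u 0| * (|ξ 1| * |ξ 2|) + |u 1| * (|ξ 0| * |ξ 2|)
      + |u 2| * (|ξ 0| * |ξ 1|)) ≤ quadForm u ξ := by
  have h0 := neg_abs_le (u 0 * (ξ 1 * ξ 2))
  have h1 := neg_abs_le (u 1 * (ξ 0 * ξ 2))
  have h2 := neg_abs_le (u 2 * (ξ 0 * ξ 1))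
  simp only [abs_mul] at h0 h1 h2
  unfold quadForm
  linarith

theorem integrable_symbol {u : Fin 3 → ℝ} (hu : IsSubcritical u) (r : Fin 3 → ℕ) :
    Integrable (symbol u r) := by
  refine (integrable_absMonomial_mul_exp hu r).mono' (continuous_symbol u r).aestronglyMeasurable
    (Filter.Eventually.of_forall fun ξ => ?_)
  rw [norm_symbol]
  refine mul_le_mul_of_nonneg_left (Real.exp_le_exp.2 (neg_le_neg (lower_bound_quadForm u ξ)))
    (Finset.prod_nonneg fun i _ => by positivity)

theorem symbol_add_single (u : Fin 3 → ℝ) (r : Fin 3 → ℕ) (j : Fin 3) (ξ : Fin 3 → ℝ) :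
    symbol u (r + Pi.single j 1) ξ = -(Complex.I * ξ j) * symbol u r ξ := by
  unfold symbol
  rw [← mul_assoc]
  congr 1
  simp only [Pi.add_apply, pow_add, Finset.prod_mul_distrib]
  rw [mul_comm]
  congr 1
  rw [Finset.prod_eq_single j (fun i _ hi => by simp [hi]) (by simp)]
  simp

theorem hasDerivAt_wave (x ξ : Fin 3 → ℝ) (j : Fin 3) (t : ℝ) :
    HasDerivAt (fun t => wave (Function.update x j t) ξ)
      (Complex.I * ξ j * wave (Function.update x j t) ξ) t := by
  have h : ∀ t, ∑ i, Function.update x j t i * ξ i = ∑ i, x i * ξ i + (t - x j) * ξ j := fun t => by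
    fin_cases j <;> simp [Fin.sum_univ_three, Function.update] <;> ring
  have h1 : HasDerivAt (fun t : ℝ => ∑ i, x i * ξ i + (t - x j) * ξ j) (ξ j) t := by
    simpa using (((hasDerivAt_id t).sub_const (x j)).mul_const (ξ j)).const_add (∑ i, x i * ξ i)
  simp only [wave, h]
  refine (h1.ofReal_comp.const_mul Complex.I).cexp.congr_deriv ?_
  ring

/-- Since the factor w has modulus one, ‖g'‖ dominates the t-derivative of the integrand for all t
at once. -/
theorem hasDerivAt_integral_mul_of_norm_eq_one {α : Type*} [MeasurableSpace α] {μ : Measure α}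
    {g g' : α → ℂ} {w : ℝ → α → ℂ} {k : α → ℂ} (hg : Integrable g μ) (hg' : Integrable g' μ)
    (hgg' : ∀ a, g a * k a = g' a) (hw : ∀ t, AEStronglyMeasurable (w t) μ)
    (hw1 : ∀ t a, ‖w t a‖ = 1) (hwd : ∀ t a, HasDerivAt (fun t => w t a) (k a * w t a) t) (t : ℝ) :
    HasDerivAt (fun t => ∫ a, g a * w t a ∂μ) (∫ a, g' a * w t a ∂μ) t := by
  have hi : Integrable (fun a => g a * w t a) μ :=
    hg.norm.mono' (hg.1.mul (hw t)) (Filter.Eventually.of_forall fun a => by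
      rw [norm_mul, hw1, mul_one])
  refine (hasDerivAt_integral_of_dominated_loc_of_deriv_le (F := fun t a => g a * w t a)
    (F' := fun t a => g' a * w t a) (bound := fun a => ‖g' a‖) Filter.univ_mem
    (Filter.Eventually.of_forall fun t => hg.1.mul (hw t)) hi (hg'.1.mul (hw t))
    (Filter.Eventually.of_forall fun a t _ => ?_) hg'.norm
    (Filter.Eventually.of_forall fun a t _ => ?_)).2
  · rw [norm_mul, hw1, mul_one]
  · refine ((hwd t a).const_mul (g a)).congr_deriv ?_
    rw [← hgg', mul_assoc]

theorem pderiv_fourierGauss {u : Fin 3 → ℝ} (hu : IsSubcritical u) (r : Fin 3 → ℕ) (j : Fin 3) :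
    pderiv j (fourierGauss u r) = fun x => -fourierGauss u (r + Pi.single j 1) x := by
  ext x
  have h := hasDerivAt_integral_mul_of_norm_eq_one (w := fun t => wave (Function.update x j t))
    (k := fun ξ => Complex.I * ξ j) (integrable_symbol hu r)
    (integrable_symbol hu (r + Pi.single j 1)).neg
    (fun ξ => by rw [Pi.neg_apply, symbol_add_single]; ring)
    (fun t => (continuous_wave _).aestronglyMeasurable) (fun t => norm_wave _)
    (fun t ξ => hasDerivAt_wave x ξ j t) (x j)
  have hre : ∀ {f : ℝ → ℂ} {f' : ℂ} {t : ℝ}, HasDerivAt f f' t →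
      HasDerivAt (fun t => (f t).re) f'.re t := fun hf =>
    Complex.reCLM.hasFDerivAt.comp_hasDerivAt _ hf
  rw [pderiv]
  simp only [fourierGauss]
  rw [(hre h).deriv, Function.update_eq_self]
  simp only [Pi.neg_apply, neg_mul, integral_neg, Complex.neg_re]

theorem fourierGauss_add_single {u : Fin 3 → ℝ} (hu : IsSubcritical u) (r : Fin 3 → ℕ)
    (j : Fin 3) (n : ℕ) :
    fourierGauss u (r + Pi.single j n) =
      fun x => (-1) ^ n * (pderiv j)^[n] (fourierGauss u r) x := by
  induction n with
  | zero => simp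
  | succ n ih =>
    have h := pderiv_fourierGauss hu (r + Pi.single j n) j
    rw [add_assoc, ← Pi.single_add, ih] at h
    have h' := pderiv_iterate_const_mul j 1 ((-1) ^ n) ((pderiv j)^[n] (fourierGauss u r))
    rw [Function.iterate_one] at h'
    rw [h'] at h
    ext x
    have hx := congrFun h x
    rw [Function.iterate_succ_apply', pow_succ]
    linarith

/-! ### The Gaussian integral -/

/-- The unitriangular substitution that diagonalizes `quadForm u`. -/
def triangular (u : Fin 3 → ℝ) : Matrix (Fin 3) (Fin 3) ℝ :=
  !![1, -2 * u 2, -2 * u 1 + 2 * u 2 * ((2 * u 0 - 4 * u 1 * u 2) / (1 - 4 * u 2 ^ 2));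
     0, 1, -((2 * u 0 - 4 * u 1 * u 2) / (1 - 4 * u 2 ^ 2));
     0, 0, 1]

theorem det_triangular (u : Fin 3 → ℝ) : (triangular u).det = 1 := by
  simp [triangular, Matrix.det_fin_three]

/-- The diagonal coefficients of `quadForm u` after the substitution `triangular u`. -/
def pivot (u : Fin 3 → ℝ) : Fin 3 → ℝ :=
  ![1 / 4, (1 - 4 * u 2 ^ 2) / 4, discr u / (4 * (1 - 4 * u 2 ^ 2))]

theorem quadForm_triangular {u : Fin 3 → ℝ} (h : 0 < 1 - 4 * u 2 ^ 2) (η : Fin 3 → ℝ) :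
    quadForm u ((triangular u).mulVec η) = ∑ i, pivot u i * η i ^ 2 := by
  have := h.ne'
  simp only [quadForm, triangular, Matrix.mulVec, dotProduct, Fin.sum_univ_three, pivot, discr]
  simp
  field_simp
  ring

/-- A substitution of determinant one preserves Lebesgue measure. -/
theorem integral_comp_triangular (u : Fin 3 → ℝ) {f : (Fin 3 → ℝ) → ℂ} (hf : Continuous f) :
    ∫ η, f ((triangular u).mulVec η) = ∫ ξ, f ξ := by
  have h := Real.map_matrix_volume_pi_eq_smul_volume_pi (M := triangular u)
    (by rw [det_triangular]; exact one_ne_zero)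
  simp only [det_triangular, inv_one, abs_one, ENNReal.ofReal_one, one_smul] at h
  have hm : Continuous (Matrix.toLin' (triangular u)) :=
    LinearMap.continuous_of_finiteDimensional _
  conv_rhs => rw [← h, integral_map hm.aemeasurable hf.aestronglyMeasurable]
  simp [Matrix.toLin'_apply]

/-- In the triangular coordinates the integral is a product of three one-variable Gaussian
integrals. The product of the pivots is Δ/64, which gives the constant, and the exponents add up to
xᵀA⁻¹x. -/
theorem fourierGauss_zero {u : Fin 3 → ℝ} (hu : IsSubcritical u) :
    fourierGauss u 0 = fun x => (2 * √Real.pi) ^ 3 / √(discr u) * gauss u x := by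
  ext x
  have hD := hu.discr_pos
  have h2 := hu.one_sub_pos 2
  have hp : ∀ i, 0 < pivot u i := by
    intro i
    fin_cases i
    · norm_num [pivot]
    · exact div_pos h2 (by norm_num)
    · exact div_pos hD (by positivity)
  set c : Fin 3 → ℝ := (triangular u).transpose.mulVec x with hc
  have hval : ∫ ξ, symbol u 0 ξ * wave x ξ =
      ((∏ i, (√(Real.pi / pivot u i) * Real.exp (-(c i ^ 2 / (4 * pivot u i)))) : ℝ) : ℂ) := by
    rw [← integral_comp_triangular u (f := fun ξ => symbol u 0 ξ * wave x ξ)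
      ((continuous_symbol u 0).mul (continuous_wave x))]
    have e : ∀ η : Fin 3 → ℝ, symbol u 0 ((triangular u).mulVec η) *
        wave x ((triangular u).mulVec η) = Complex.exp (-∑ i, ((pivot u i : ℝ) : ℂ) * (η i : ℂ) ^ 2
          + ∑ i, (Complex.I * (c i : ℂ)) * η i) := by
      intro η
      rw [symbol, wave, quadForm_triangular h2, Complex.exp_add]
      have e2 : ∑ i, x i * (triangular u).mulVec η i = ∑ i, c i * η i := by
        have := Matrix.dotProduct_mulVec x (triangular u) η
        rw [hc, Matrix.mulVec_transpose]
        exact this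
      rw [e2]
      simp [Finset.mul_sum, mul_assoc]
    simp only [e]
    rw [GaussianFourier.integral_cexp_neg_sum_mul_add (by simpa using hp), Complex.ofReal_prod]
    refine Finset.prod_congr rfl fun i _ => ?_
    rw [Complex.ofReal_mul, Real.sqrt_eq_rpow, Complex.ofReal_cpow (by have := hp i; positivity),
      Complex.ofReal_exp]
    congr 1
    · push_cast
      rfl
    · congr 1
      push_cast
      rw [mul_pow, Complex.I_sq]
      ring
  rw [fourierGauss, hval, Complex.ofReal_re, Finset.prod_mul_distrib, ← Real.exp_sum]
  congr 1
  · rw [← Real.sqrt_prod _ (fun i _ => by have := hp i; positivity)]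
    have e : ∏ i, Real.pi / pivot u i = (2 ^ 2 * Real.pi) ^ 3 / discr u := by
      simp [Fin.prod_univ_three, pivot]
      field_simp
      norm_num
    have e3 : ((2 : ℝ) * √Real.pi) ^ 3 = √((2 ^ 2 * Real.pi) ^ 3) := by
      rw [show (2 ^ 2 * Real.pi) ^ 3 = ((2 * √Real.pi) ^ 3) ^ 2 by
        rw [← pow_mul, mul_comm 3 2, pow_mul, mul_pow 2 √Real.pi, Real.sq_sqrt Real.pi_pos.le]]
      rw [Real.sqrt_sq (by positivity)]
    rw [e, Real.sqrt_div (by positivity), e3]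
  · rw [gauss, Finset.sum_neg_distrib]
    congr 2
    -- The second pivot is kept as an opaque symbol while denominators are cleared, and expanded
    -- only for the final polynomial identity.
    obtain ⟨d, hd⟩ : ∃ d, d = 1 - 4 * u 2 ^ 2 := ⟨_, rfl⟩
    rw [← hd] at h2
    have := h2.ne'
    have := hD.ne'
    simp only [hc, invForm, triangular, Matrix.mulVec, dotProduct, Fin.sum_univ_three, pivot, ← hd]
    simp
    field_simp
    simp only [discr, Fin.sum_univ_three, hd]
    ring

/-- The Fourier integral as a mixed derivative of the Gaussian. -/
theorem fourierGauss_eq_pderiv {u : Fin 3 → ℝ} (hu : IsSubcritical u) (r : Fin 3 → ℕ)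
    (x : Fin 3 → ℝ) :
    fourierGauss u r x = (2 * √Real.pi) ^ 3 / √(discr u) * ((∏ i, (-1) ^ r i) *
      (pderiv 2)^[r 2] ((pderiv 1)^[r 1] ((pderiv 0)^[r 0] (gauss u))) x) := by
  have hr : r = 0 + Pi.single 0 (r 0) + Pi.single 1 (r 1) + Pi.single 2 (r 2) := by
    ext i
    fin_cases i <;> simp
  have e : fourierGauss u r = fourierGauss u
      (0 + Pi.single 0 (r 0) + Pi.single 1 (r 1) + Pi.single 2 (r 2)) := by rw [← hr]
  rw [e]
  simp only [fourierGauss_add_single hu, fourierGauss_zero hu, pderiv_iterate_const_mul,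
    Fin.prod_univ_three]
  ring

/-! ### Summation -/

theorem hasSum_of_eq {ι : Type*} {𝕜 : Type*} [NormedField 𝕜] {f g : ι → 𝕜} {a b : 𝕜}
    (h : HasSum f a) (hfg : ∀ q, g q = f q) (hab : b = a) : HasSum g b := by
  rw [funext hfg, hab]
  exact h

theorem hasSum_triple_mul {𝕜 : Type*} [NormedField 𝕜] [CompleteSpace 𝕜] {f g h : ℕ → 𝕜}
    {a b c : 𝕜} (hf : HasSum f a) (hg : HasSum g b) (hh : HasSum h c)
    (hf' : Summable fun n => ‖f n‖) (hg' : Summable fun n => ‖g n‖)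
    (hh' : Summable fun n => ‖h n‖) :
    HasSum (fun q : ℕ × ℕ × ℕ => f q.1 * (g q.2.1 * h q.2.2)) (a * (b * c)) := by
  have hgh : Summable fun q : ℕ × ℕ => ‖g q.1 * h q.2‖ := hg'.mul_norm hh'
  have hgh' : HasSum (fun q : ℕ × ℕ => g q.1 * h q.2) (b * c) :=
    hg.mul hh (summable_mul_of_summable_norm hg' hh')
  have hfgh : Summable fun q : ℕ × ℕ × ℕ => f q.1 * (g q.2.1 * h q.2.2) :=
    summable_mul_of_summable_norm (f := f) (g := fun q : ℕ × ℕ => g q.1 * h q.2) hf' hgh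
  exact HasSum.mul (f := f) (g := fun q : ℕ × ℕ => g q.1 * h q.2) hf hgh' hfgh

theorem hasSum_cexp_triple (a b c : ℂ) :
    HasSum (fun q : ℕ × ℕ × ℕ => a ^ q.1 / (q.1 ! : ℂ) *
      (b ^ q.2.1 / (q.2.1 ! : ℂ) * (c ^ q.2.2 / (q.2.2 ! : ℂ)))) (Complex.exp (a + b + c)) := by
  have h : ∀ a : ℂ, HasSum (fun n : ℕ => a ^ n / (n ! : ℂ)) (Complex.exp a) := fun a => by
    rw [Complex.exp_eq_exp_ℂ]
    exact NormedSpace.expSeries_div_hasSum_exp a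
  have hn : ∀ a : ℂ, Summable (fun n : ℕ => ‖a ^ n / (n ! : ℂ)‖) :=
    fun a => NormedSpace.norm_expSeries_div_summable a
  rw [add_assoc, Complex.exp_add, Complex.exp_add]
  exact hasSum_triple_mul (f := fun n => a ^ n / (n !)) (g := fun n => b ^ n / (n !))
    (h := fun n => c ^ n / (n !)) (h a) (h b) (h c) (hn a) (hn b) (hn c)

theorem hasSum_exp_triple (a b c : ℝ) :
    HasSum (fun q : ℕ × ℕ × ℕ => a ^ q.1 / (q.1 ! : ℝ) *
      (b ^ q.2.1 / (q.2.1 ! : ℝ) * (c ^ q.2.2 / (q.2.2 ! : ℝ)))) (Real.exp (a + b + c)) := by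
  have h : ∀ a : ℝ, HasSum (fun n : ℕ => a ^ n / (n ! : ℝ)) (Real.exp a) := fun a => by
    rw [Real.exp_eq_exp_ℝ]
    exact NormedSpace.expSeries_div_hasSum_exp a
  have hn : ∀ a : ℝ, Summable (fun n : ℕ => ‖a ^ n / (n ! : ℝ)‖) :=
    fun a => NormedSpace.norm_expSeries_div_summable a
  rw [add_assoc, Real.exp_add, Real.exp_add]
  exact hasSum_triple_mul (f := fun n => a ^ n / (n !)) (g := fun n => b ^ n / (n !))
    (h := fun n => c ^ n / (n !)) (h a) (h b) (h c) (hn a) (hn b) (hn c)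

/-- The degrees of the Hermite polynomials in the term with index `q` of the series. -/
def shift (r : Fin 3 → ℕ) (q : ℕ × ℕ × ℕ) : Fin 3 → ℕ :=
  ![q.2.1 + q.2.2 + r 0, q.2.2 + q.1 + r 1, q.1 + q.2.1 + r 2]

/-- The coefficient of the term with index `q` of the series. -/
def coeff (u : Fin 3 → ℝ) (q : ℕ × ℕ × ℕ) : ℝ :=
  u 0 ^ q.1 / (q.1 ! : ℝ) * (u 1 ^ q.2.1 / (q.2.1 ! : ℝ) * (u 2 ^ q.2.2 / (q.2.2 ! : ℝ)))

/-- Each summation index raises exactly two of the degrees, so it contributes powers of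
(-iξ_j)(-iξ_k) = -ξ_jξ_k. -/
theorem coeff_mul_symbol_shift (u : Fin 3 → ℝ) (r : Fin 3 → ℕ) (q : ℕ × ℕ × ℕ) (ξ : Fin 3 → ℝ) :
    coeff u q * symbol 0 (shift r q) ξ = symbol 0 r ξ *
      ((-(u 0 * (ξ 1 * ξ 2)) : ℂ) ^ q.1 / (q.1 ! : ℂ) *
        ((-(u 1 * (ξ 0 * ξ 2)) : ℂ) ^ q.2.1 / (q.2.1 ! : ℂ) *
          ((-(u 2 * (ξ 0 * ξ 1)) : ℂ) ^ q.2.2 / (q.2.2 ! : ℂ)))) := by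
  obtain ⟨m, n, p⟩ := q
  have hI : ∀ a b c : ℂ, -(a * (b * c)) = a * ((-(Complex.I * b)) * (-(Complex.I * c))) := by
    intro a b c
    linear_combination (-a * b * c) * Complex.I_mul_I
  simp only [coeff, symbol, shift, Fin.prod_univ_three, hI]
  -- Hiding -iξ_i behind a symbol lets the powers be collected without expanding them.
  generalize hy : (fun i => -(Complex.I * (ξ i : ℂ))) = y
  have hy' : ∀ i, -(Complex.I * (ξ i : ℂ)) = y i := fun i => congrFun hy i
  simp [hy', pow_add, mul_pow, -neg_mul]
  ring

theorem hasSum_symbol (u : Fin 3 → ℝ) (r : Fin 3 → ℕ) (ξ : Fin 3 → ℝ) :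
    HasSum (fun q => coeff u q * symbol 0 (shift r q) ξ) (symbol u r ξ) := by
  refine hasSum_of_eq ((hasSum_cexp_triple (-(u 0 * (ξ 1 * ξ 2)) : ℂ) (-(u 1 * (ξ 0 * ξ 2)))
    (-(u 2 * (ξ 0 * ξ 1)))).mul_left (symbol 0 r ξ)) (fun q => coeff_mul_symbol_shift u r q ξ) ?_
  rw [symbol, symbol, mul_assoc, ← Complex.exp_add]
  congr 2
  simp [quadForm]
  ring

/-- The dominating function: taking norms destroys the signs of the cross terms, which is why the
coercivity bound is stated with |u_k| and |ξ_i|. -/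
theorem hasSum_norm_symbol (u : Fin 3 → ℝ) (r : Fin 3 → ℕ) (ξ : Fin 3 → ℝ) :
    HasSum (fun q => ‖coeff u q * symbol 0 (shift r q) ξ‖) (absMonomial r ξ *
      Real.exp (-((1 / 4) * ∑ i, ξ i ^ 2 - (|u 0| * (|ξ 1| * |ξ 2|) + |u 1| * (|ξ 0| * |ξ 2|)
        + |u 2| * (|ξ 0| * |ξ 1|))))) := by
  refine hasSum_of_eq ((hasSum_exp_triple (|u 0| * (|ξ 1| * |ξ 2|)) (|u 1| * (|ξ 0| * |ξ 2|))
    (|u 2| * (|ξ 0| * |ξ 1|))).mul_left ‖symbol 0 r ξ‖) (fun q => ?_) ?_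
  · rw [coeff_mul_symbol_shift]
    simp
  · rw [norm_symbol, mul_assoc, ← Real.exp_add]
    congr 2
    simp [quadForm]
    ring

theorem hasSum_fourierGauss {u : Fin 3 → ℝ} (hu : IsSubcritical u) (r : Fin 3 → ℕ)
    (x : Fin 3 → ℝ) :
    HasSum (fun q => coeff u q * fourierGauss 0 (shift r q) x) (fourierGauss u r x) := by
  have hnorm : ∀ q ξ, ‖coeff u q * symbol 0 (shift r q) ξ * wave x ξ‖ =
      ‖coeff u q * symbol 0 (shift r q) ξ‖ := fun q ξ => by rw [norm_mul, norm_wave, mul_one]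
  have h := hasSum_integral_of_dominated_convergence (μ := volume)
    (F := fun q ξ => coeff u q * symbol 0 (shift r q) ξ * wave x ξ)
    (f := fun ξ => symbol u r ξ * wave x ξ)
    (fun q ξ => ‖coeff u q * symbol 0 (shift r q) ξ‖)
    (fun q => ((continuous_const.mul (continuous_symbol _ _)).mul
      (continuous_wave x)).aestronglyMeasurable)
    (fun q => Filter.Eventually.of_forall fun ξ => (hnorm q ξ).le)
    (Filter.Eventually.of_forall fun ξ => (hasSum_norm_symbol u r ξ).summable)
    (by
      simp only [fun ξ => (hasSum_norm_symbol u r ξ).tsum_eq]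
      exact integrable_absMonomial_mul_exp hu r)
    (Filter.Eventually.of_forall fun ξ => (hasSum_symbol u r ξ).mul_right _)
  refine hasSum_of_eq (Complex.hasSum_re h) (fun q => ?_) rfl
  simp only [mul_assoc]
  rw [integral_const_mul, Complex.re_ofReal_mul, fourierGauss]

/-- For u = 0 the matrix A is the identity and X_i = x_i, so each Hermite factor is constant for the
later derivatives and no Leibniz sum appears. -/
theorem fourierGauss_zero_left (s : Fin 3 → ℕ) (x : Fin 3 → ℝ) :
    fourierGauss 0 s x = (2 * √Real.pi) ^ 3 *
      (hermiteH (s 0) (x 0) * hermiteH (s 1) (x 1) * hermiteH (s 2) (x 2)) *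
        Real.exp (-∑ i, x i ^ 2) := by
  have hD : discr 0 = 1 := by simp [discr]
  have hX : ∀ i y, argX 0 i y = y i := fun i y => by simp [argX, hD]
  have hg : gauss 0 x = Real.exp (-∑ i, x i ^ 2) := by simp [gauss, invForm, hD]
  have hG : ∀ i n, (pderiv i)^[n] (gauss 0) =
      fun y => (-1) ^ n * (hermiteH n (y i) * gauss 0 y) := fun i n => by
    rw [pderiv_iterate_gauss isSubcritical_zero.discr_pos (isSubcritical_zero.one_sub_pos i)]
    simp [hX, scale, hD]
  have h1 : ∀ (i j : Fin 3) (n : ℕ), i ≠ j → ∀ (y : Fin 3 → ℝ) t,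
      hermiteH n (Function.update y j t i) = hermiteH n (y i) :=
    fun i j n hij y t => by rw [Function.update_of_ne hij]
  have hs : ∀ n : ℕ, ((-1 : ℝ) ^ n) * (-1) ^ n = 1 := fun n => by rw [← mul_pow]; simp
  rw [fourierGauss_eq_pderiv isSubcritical_zero, hG, pderiv_iterate_const_mul,
    pderiv_iterate_invariant_mul (f := fun y => hermiteH (s 0) (y 0)) (h1 0 1 _ (by decide)), hG,
    pderiv_iterate_const_mul,
    pderiv_iterate_invariant_mul (f := fun y => hermiteH (s 0) (y 0)) (h1 0 2 _ (by decide)),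
    pderiv_iterate_const_mul,
    pderiv_iterate_invariant_mul (f := fun y => hermiteH (s 1) (y 1)) (h1 1 2 _ (by decide)), hG, ← hg, hD, Fin.prod_univ_three]
  simp only [Real.sqrt_one, div_one]
  calc _ = (((-1 : ℝ) ^ s 0) * (-1) ^ s 0) * (((-1 : ℝ) ^ s 1) * (-1) ^ s 1) *
        (((-1 : ℝ) ^ s 2) * (-1) ^ s 2) * ((2 * √Real.pi) ^ 3 *
      (hermiteH (s 0) (x 0) * hermiteH (s 1) (x 1) * hermiteH (s 2) (x 2)) * gauss 0 x) := by ring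
    _ = _ := by rw [hs, hs, hs]; ring

/-- The extra 1 in the exponent of Δ comes from the determinant factor of the Gaussian integral. -/
theorem prod_scale_pow {u : Fin 3 → ℝ} (hu : IsSubcritical u) (r : Fin 3 → ℕ) :
    1 / √(discr u) * ∏ i, scale u i ^ r i =
      discr u ^ (-(((r 0 + r 1 + r 2 + 1 : ℕ) : ℝ) / 2)) *
        ∏ i, (1 - 4 * u i ^ 2) ^ ((r i : ℝ) / 2) := by
  have hD := hu.discr_pos
  have hs : ∀ i, scale u i ^ r i =
      discr u ^ (-((r i : ℝ) / 2)) * (1 - 4 * u i ^ 2) ^ ((r i : ℝ) / 2) := fun i => by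
    have hi := hu.one_sub_pos i
    rw [scale, Real.sqrt_eq_rpow, ← Real.rpow_natCast, ← Real.rpow_mul (by positivity),
      Real.div_rpow hi.le hD.le, Real.rpow_neg hD.le, one_div_mul_eq_div]
    ring
  have h0 : 1 / √(discr u) = discr u ^ (-(1 / 2 : ℝ)) := by
    rw [Real.rpow_neg hD.le, Real.sqrt_eq_rpow, one_div]
  simp only [hs, Fin.prod_univ_three, h0]
  have e : discr u ^ (-(((r 0 + r 1 + r 2 + 1 : ℕ) : ℝ) / 2)) = discr u ^ (-(1 / 2 : ℝ)) *
      discr u ^ (-((r 0 : ℝ) / 2)) * discr u ^ (-((r 1 : ℝ) / 2)) *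
        discr u ^ (-((r 2 : ℝ) / 2)) := by
    rw [← Real.rpow_add hD, ← Real.rpow_add hD, ← Real.rpow_add hD]
    congr 1
    push_cast
    ring
  rw [e]
  ring

end CarlitzMehler

end

/-- Generalized Carlitz–Mehler formula. The triple series converges absolutely (unconditionally)
and has the stated sum. -/
theorem mainTheorem1 (r : Fin 3 → ℕ) (u x : Fin 3 → ℝ)
    (hu : 4 * ∑ i, u i ^ 2 + 16 * |u 0 * u 1 * u 2| < 1) :
    HasSum
      (fun q : ℕ × ℕ × ℕ =>
        let m := q.1
        let n := q.2.1
        let p := q.2.2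
        CarlitzMehler.hermiteH (n + p + r 0) (x 0) *
          CarlitzMehler.hermiteH (p + m + r 1) (x 1) *
          CarlitzMehler.hermiteH (m + n + r 2) (x 2) *
          (u 0 ^ m / (m.factorial : ℝ)) * (u 1 ^ n / (n.factorial : ℝ)) *
          (u 2 ^ p / (p.factorial : ℝ)))
      (CarlitzMehler.discr u ^ (-(((r 0 + r 1 + r 2 + 1 : ℕ) : ℝ) / 2)) *
        (∏ i, (1 - 4 * u i ^ 2) ^ ((r i : ℝ) / 2)) *
        Real.exp (CarlitzMehler.carlitzExponent u x) *
        ∑ k ∈ CarlitzMehler.indexSet r,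
          CarlitzMehler.weight u r k * CarlitzMehler.nestedTerm u r k x) := by
  have hs : CarlitzMehler.IsSubcritical u := hu
  have hC : (2 * √Real.pi) ^ 3 ≠ 0 := by positivity
  have hE : Real.exp (∑ i, x i ^ 2) * Real.exp (-∑ i, x i ^ 2) = 1 := by
    rw [← Real.exp_add, add_neg_cancel, Real.exp_zero]
  have hexp : Real.exp (CarlitzMehler.carlitzExponent u x) =
      Real.exp (∑ i, x i ^ 2) * CarlitzMehler.gauss u x := by
    rw [CarlitzMehler.gauss, ← Real.exp_add, ← sub_eq_add_neg]
    rfl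
  have hsign : (∏ i, (-1 : ℝ) ^ r i) * ∏ i, (-CarlitzMehler.scale u i) ^ r i =
      ∏ i, CarlitzMehler.scale u i ^ r i := by
    rw [← Finset.prod_mul_distrib]
    exact Finset.prod_congr rfl fun i _ => by rw [← mul_pow]; simp
  -- The multiplier removes the constant and the weight e^{-|x|²} that accompany the Hermite
  -- products at u = 0.
  refine CarlitzMehler.hasSum_of_eq ((CarlitzMehler.hasSum_fourierGauss hs r x).mul_left
    (Real.exp (∑ i, x i ^ 2) / (2 * √Real.pi) ^ 3)) (fun q => ?_) ?_
  · rw [CarlitzMehler.fourierGauss_zero_left]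
    simp only [CarlitzMehler.coeff, CarlitzMehler.shift]
    generalize Real.exp (∑ i, x i ^ 2) = e at hE ⊢
    generalize Real.exp (-∑ i, x i ^ 2) = e' at hE ⊢
    simp only [Matrix.cons_val]
    field_simp
    rw [mul_assoc _ e e', hE, mul_one]
  · rw [CarlitzMehler.fourierGauss_eq_pderiv hs, CarlitzMehler.pderiv_gauss_eq_sum hs.discr_pos
      hs.one_sub_pos, ← CarlitzMehler.prod_scale_pow hs, hexp, ← hsign]
    field_simp
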